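/- Let $m\ge 1$ and let $\mathcal E,\mathcal E_*$ be complex Hilbert spaces. For a Hilbert space $\mathcal F$, let $H^2_m\otimes\mathcal F$ denote the $\mathcal F$-valued Drury--Arveson space on the open unit ball $\mathbb B^m\subset\mathbb C^m$, i.e. the Hilbert space of functions $f(z)=\sum_{k\in\mathbb N^m}a_kz^k$, $a_k\in\mathcal F$, with $\|f\|^2=\sum_k\|a_k\|^2/\gamma_k<\infty$, where $\gamma_k=\frac{(k_1+\cdots+k_m)!}{k_1!\cdots k_m!}$; equivalently, the reproducing kernel Hilbert space with kernel $(1-\sum_{i=1}^m z_i\bar w_i)^{-1}I_{\mathcal F}$. It is a Hilbert module over $\mathbb C[z_1,\dots,z_m]$ in which $z_i$ acts as multiplication by the $i$-th coordinate, and a submodule is a norm-closed linear subspace that is invariant under multiplication by $z_1,\dots,z_m$. Let $\mathcal M(\mathcal E,\mathcal E_*)$ be the set of multipliers, that is, of holomorphic functions $\varphi:\mathbb B^m\to\mathcal L(\mathcal E,\mathcal E_*)$ such that $\varphi f\in H^2_m\otimes\mathcal E_*$ for all $f\in H^2_m\otimes\mathcal E$, and let $M_\varphi:H^2_m\otimes\mathcal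 E\to H^2_m\otimes\mathcal E_*$, $M_\varphi f=\varphi f$, be the corresponding (automatically bounded) multiplication operator. Let $\theta\in\mathcal M(\mathcal E,\mathcal E_*)$. Then there exists a multiplier $\psi\in\mathcal M(\mathcal E_*,\mathcal E)$ such that $$M_\theta M_\psi M_\theta=M_\theta$$ if and only if $\operatorname{ran}M_\theta$ is complemented in $H^2_m\otimes\mathcal E_*$, that is, there is a submodule $\mathcal S$ of $H^2_m\otimes\mathcal E_*$ such that $H^2_m\otimes\mathcal E_*$ is the algebraic direct sum $\operatorname{ran}M_\theta\,\dot+\,\mathcal S$. -/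

import Mathlib

noncomputable section

namespace DruryArveson

set_option linter.unusedSectionVars false

/-- The open unit ball of `ℂ^m` (Euclidean norm). -/
abbrev Ball (m : ℕ) : Type := Metric.ball (0 : EuclideanSpace ℂ (Fin m)) 1

/-- The multinomial coefficient `γ_k = (k₁ + ⋯ + k_m)! / (k₁! ⋯ k_m!)`. -/
def γ {m : ℕ} (k : Fin m → ℕ) : ℕ := Nat.multinomial Finset.univ k

/-- The monomial `z^k`. -/
def monom {m : ℕ} (z : EuclideanSpace ℂ (Fin m)) (k : Fin m → ℕ) : ℂ := ∏ i, z i ^ k i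

/-- The Drury-Arveson space `H²_m ⊗ E` of `E`-valued functions on the ball. The function
`f(z) = ∑ a_k z^k` with `‖f‖² = ∑ ‖a_k‖² / γ_k` is stored through the square-summable family
of its normalized coefficients `a_k / √γ_k`; see `coeff`, `norm_sq_eq`, `hasSum_apply`,
`exists_of_summable` and `kernel_eq`. -/
def H2 (m : ℕ) (E : Type*) [NormedAddCommGroup E] : Type _ := lp (fun _ : Fin m → ℕ => E) 2

section space

variable {m : ℕ} {E : Type*} [NormedAddCommGroup E]

instance : NormedAddCommGroup (H2 m E) :=
  inferInstanceAs (NormedAddCommGroup (lp (fun _ : Fin m → ℕ => E) 2))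

variable [InnerProductSpace ℂ E]

instance : InnerProductSpace ℂ (H2 m E) :=
  inferInstanceAs (InnerProductSpace ℂ (lp (fun _ : Fin m → ℕ => E) 2))

instance [CompleteSpace E] : CompleteSpace (H2 m E) :=
  inferInstanceAs (CompleteSpace (lp (fun _ : Fin m → ℕ => E) 2))

/-- The normalized coefficient `a_k / √γ_k` of `f(z) = ∑ a_k z^k`. -/
def normCoeff (f : H2 m E) (k : Fin m → ℕ) : E :=
  (show lp (fun _ : Fin m → ℕ => E) 2 from f).1 k

/-- The power series coefficient `a_k` of `f(z) = ∑ a_k z^k`. -/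
def coeff (f : H2 m E) (k : Fin m → ℕ) : E := (√(γ k) : ℝ) • normCoeff f k

lemma γ_pos (k : Fin m → ℕ) : 0 < γ k := Nat.multinomial_pos _ _

lemma sqrt_γ_pos (k : Fin m → ℕ) : 0 < √(γ k : ℝ) :=
  Real.sqrt_pos.2 (by exact_mod_cast γ_pos k)

lemma hasSum_normCoeff (f : H2 m E) : HasSum (fun k => ‖normCoeff f k‖ ^ 2) (‖f‖ ^ 2) := by
  have := lp.hasSum_norm (p := 2) (by norm_num) (show lp (fun _ : Fin m → ℕ => E) 2 from f)
  simp only [ENNReal.toReal_ofNat, Real.rpow_ofNat] at this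
  exact this

/-- `‖f‖² = ∑ ‖a_k‖² / γ_k`. -/
lemma norm_sq_eq (f : H2 m E) : HasSum (fun k => ‖coeff f k‖ ^ 2 / γ k) (‖f‖ ^ 2) := by
  convert hasSum_normCoeff f using 2 with k
  have h : (0 : ℝ) < γ k := by exact_mod_cast γ_pos k
  rw [coeff, norm_smul, mul_pow, Real.norm_eq_abs, sq_abs, Real.sq_sqrt h.le]
  field_simp

lemma hasSum_degree {A : Type*} [AddCommMonoid A] [TopologicalSpace A] (f : (Fin m → ℕ) → A)
    (n : ℕ) : HasSum (fun k : {k : Fin m → ℕ // ∑ i, k i = n} => f k.1)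
      (∑ k ∈ Finset.piAntidiag Finset.univ n, f k) := by
  have h := Finset.hasSum (Finset.piAntidiag (Finset.univ : Finset (Fin m)) n) f
  let e : {k : Fin m → ℕ // ∑ i, k i = n} ≃
      ((Finset.piAntidiag (Finset.univ : Finset (Fin m)) n : Finset _) : Set (Fin m → ℕ)) :=
    Equiv.subtypeEquivRight (by simp)
  exact (Equiv.hasSum_iff e).2 h

lemma hasSum_γ_mul_fiber {𝕜 : Type*} [RCLike 𝕜] (x : Fin m → 𝕜) (n : ℕ) :
    HasSum (fun k : {k : Fin m → ℕ // ∑ i, k i = n} => (γ k.1 : 𝕜) * ∏ i, x i ^ k.1 i)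
      ((∑ i, x i) ^ n) := by
  rw [Finset.sum_pow_eq_sum_piAntidiag]
  exact hasSum_degree (fun k : Fin m → ℕ => (γ k : 𝕜) * ∏ i, x i ^ k i) n

/-- The negative multinomial series `∑ γ_k x^k = 1 / (1 - ∑ x_i)`. -/
lemma hasSum_γ_mul {𝕜 : Type*} [RCLike 𝕜] (x : Fin m → 𝕜) (hx : ∑ i, ‖x i‖ < 1) :
    HasSum (fun k : Fin m → ℕ => (γ k : 𝕜) * ∏ i, x i ^ k i) (1 - ∑ i, x i)⁻¹ := by
  let e := Equiv.sigmaFiberEquiv (fun k : Fin m → ℕ => ∑ i, k i)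
  have hx' : ‖∑ i, x i‖ < 1 := (norm_sum_le _ _).trans_lt hx
  rw [← e.hasSum_iff]
  refine HasSum.sigma_of_hasSum (hasSum_geometric_of_norm_lt_one hx')
    (fun n => hasSum_γ_mul_fiber x n) ?_
  refine Summable.of_norm ?_
  have key : ∀ n, HasSum (fun k : {k : Fin m → ℕ // ∑ i, k i = n} =>
      ‖(γ k.1 : 𝕜) * ∏ i, x i ^ k.1 i‖) ((∑ i, ‖x i‖) ^ n) := by
    intro n
    have h := hasSum_γ_mul_fiber (fun i => ‖x i‖) n
    have h2 : ∀ k : Fin m → ℕ, ‖(γ k : 𝕜) * ∏ i, x i ^ k i‖ = (γ k : ℝ) * ∏ i, ‖x i‖ ^ k i := by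
      intro k
      rw [norm_mul, norm_prod, RCLike.norm_natCast]
      simp only [norm_pow]
    simp only [h2]
    exact h
  refine (summable_sigma_of_nonneg (fun _ => norm_nonneg _)).2 ⟨fun n => (key n).summable, ?_⟩
  have h0 : 0 ≤ ∑ i, ‖x i‖ := Finset.sum_nonneg fun _ _ => norm_nonneg _
  refine (summable_geometric_of_lt_one h0 hx).congr fun n => ?_
  exact ((key n).tsum_eq).symm

lemma sum_norm_sq_lt_one (z : Ball m) : ∑ i, ‖z.1 i‖ ^ 2 < 1 := by
  have h := z.2
  rw [mem_ball_zero_iff, EuclideanSpace.norm_eq, Real.sqrt_lt' one_pos] at h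
  simpa using h

lemma summable_sq_monom (z : Ball m) :
    Summable fun k : Fin m → ℕ => (√(γ k : ℝ) * ‖monom z.1 k‖) ^ 2 := by
  refine (hasSum_γ_mul (fun i => ‖z.1 i‖ ^ 2)
    (by simpa using sum_norm_sq_lt_one z)).summable.congr fun k => ?_
  rw [mul_pow, Real.sq_sqrt (by positivity), monom, norm_prod, ← Finset.prod_pow]
  simp [← pow_mul, mul_comm]

lemma norm_monom_smul_coeff (f : H2 m E) (z : Ball m) (k : Fin m → ℕ) :
    ‖monom z.1 k • coeff f k‖ = (√(γ k : ℝ) * ‖monom z.1 k‖) * ‖normCoeff f k‖ := by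
  rw [coeff, norm_smul, norm_smul, Real.norm_of_nonneg (sqrt_γ_pos k).le]
  ring

lemma summable_and_tsum_le (f : H2 m E) (z : Ball m) :
    (Summable fun k => ‖monom z.1 k • coeff f k‖) ∧
      ∑' k, ‖monom z.1 k • coeff f k‖ ≤
        √(∑' k : Fin m → ℕ, (√(γ k : ℝ) * ‖monom z.1 k‖) ^ 2) * ‖f‖ := by
  simp only [norm_monom_smul_coeff]
  have := Real.summable_and_inner_le_Lp_mul_Lq_tsum_of_nonneg (p := 2) (q := 2)
    (f := fun k : Fin m → ℕ => √(γ k : ℝ) * ‖monom z.1 k‖) (g := fun k => ‖normCoeff f k‖)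
    (by constructor <;> norm_num)
    (fun k => by positivity) (fun k => norm_nonneg _)
    (by simpa using summable_sq_monom z) (by simpa using (hasSum_normCoeff f).summable)
  simp only [Real.rpow_ofNat, (hasSum_normCoeff f).tsum_eq, ← Real.sqrt_eq_rpow,
    Real.sqrt_sq (norm_nonneg f)] at this
  exact this

/-- The value `f(z) = ∑ a_k z^k`. -/
def value (f : H2 m E) (z : Ball m) : E := ∑' k, monom z.1 k • coeff f k

lemma coeff_add (f g : H2 m E) (k : Fin m → ℕ) : coeff (f + g) k = coeff f k + coeff g k :=
  smul_add _ _ _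

lemma coeff_smul (c : ℂ) (f : H2 m E) (k : Fin m → ℕ) : coeff (c • f) k = c • coeff f k :=
  smul_comm _ _ _

variable [CompleteSpace E]

lemma hasSum_value (f : H2 m E) (z : Ball m) :
    HasSum (fun k => monom z.1 k • coeff f k) (value f z) :=
  (summable_and_tsum_le f z).1.of_norm.hasSum

/-- Evaluation at a point of the ball. -/
def evalCLM (z : Ball m) : H2 m E →L[ℂ] E :=
  LinearMap.mkContinuous
    { toFun := fun f => value f z
      map_add' := fun f g => (hasSum_value (f + g) z).unique <| by
        simpa [coeff_add] using (hasSum_value f z).add (hasSum_value g z)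
      map_smul' := fun c f => (hasSum_value (c • f) z).unique <| by
        simpa [coeff_smul, smul_comm c] using (hasSum_value f z).const_smul c }
    √(∑' k : Fin m → ℕ, (√(γ k : ℝ) * ‖monom z.1 k‖) ^ 2) fun f =>
      (norm_tsum_le_tsum_norm (summable_and_tsum_le f z).1).trans (summable_and_tsum_le f z).2

lemma coeff_injective {f g : H2 m E} (h : ∀ k, coeff f k = coeff g k) : f = g := by
  refine lp.ext (funext fun k => ?_)
  exact smul_right_injective E (sqrt_γ_pos k).ne' (h k)

lemma hasSum_zero_imp {α : (Fin m → ℕ) → ℂ}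
    (hα : ∀ z : Ball m, HasSum (fun k => monom z.1 k * α k) 0) (k : Fin m → ℕ) : α k = 0 := by
  let p : ℕ → (Fin m → ℂ) → ℂ := fun n x =>
    ∑ k ∈ Finset.piAntidiag Finset.univ n, (∏ i, x i ^ k i) * α k
  have hom : ∀ n (t : ℂ) x, p n (t • x) = t ^ n * p n x := by
    intro n t x
    simp only [p, Finset.mul_sum]
    refine Finset.sum_congr rfl fun k hk => ?_
    have : ∑ i, k i = n := by simpa using hk
    simp [mul_pow, Finset.prod_mul_distrib, Finset.prod_pow_eq_pow_sum, this, mul_assoc]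
  have fiber : ∀ n (x : Fin m → ℂ), HasSum
      (fun k : {k : Fin m → ℕ // ∑ i, k i = n} => (∏ i, x i ^ k.1 i) * α k.1) (p n x) := by
    intro n x
    exact hasSum_degree (fun k => (∏ i, x i ^ k i) * α k) n
  have series : ∀ z : Ball m, HasSum (fun n => p n z.1) 0 := by
    intro z
    have h := hα z
    rw [← (Equiv.sigmaFiberEquiv (fun k : Fin m → ℕ => ∑ i, k i)).hasSum_iff] at h
    exact h.sigma fun n => fiber n z.1
  have zero : ∀ n (x : Fin m → ℂ), p n x = 0 := by
    intro n x
    let q : FormalMultilinearSeries ℂ ℂ ℂ := fun n =>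
      ContinuousMultilinearMap.mkPiRing ℂ (Fin n) (p n x)
    have hq : HasFPowerSeriesAt (0 : ℂ → ℂ) q 0 := by
      rw [hasFPowerSeriesAt_iff]
      have hc : Filter.Tendsto (fun t : ℂ => t • (WithLp.toLp 2 x : EuclideanSpace ℂ (Fin m)))
          (nhds 0) (nhds 0) := by
        have : Continuous fun t : ℂ => t • (WithLp.toLp 2 x : EuclideanSpace ℂ (Fin m)) := by
          fun_prop
        simpa using this.tendsto 0
      filter_upwards [hc.eventually (Metric.ball_mem_nhds 0 one_pos)] with t ht
      have := series ⟨_, ht⟩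
      have h2 : ∀ n, p n (t • x) = t ^ n • q.coeff n := by
        intro n
        rw [hom]
        simp [q, FormalMultilinearSeries.coeff]
      simp only [← h2]
      exact this
    have h3 := congrArg (fun q : FormalMultilinearSeries ℂ ℂ ℂ => q.coeff n) hq.eq_zero
    simpa [q, FormalMultilinearSeries.coeff] using h3
  let P : MvPolynomial (Fin m) ℂ :=
    ∑ k' ∈ Finset.piAntidiag Finset.univ (∑ i, k i),
      MvPolynomial.monomial (Finsupp.equivFunOnFinite.symm k') (α k')
  have hP : P = 0 := by
    refine MvPolynomial.funext fun x => ?_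
    rw [map_zero, ← zero (∑ i, k i) x, map_sum]
    refine Finset.sum_congr rfl fun k' _ => ?_
    rw [MvPolynomial.eval_monomial, mul_comm, Finsupp.prod_fintype _ _ (by simp)]
    simp
  have h4 := congrArg (MvPolynomial.coeff (Finsupp.equivFunOnFinite.symm k)) hP
  simpa [P, MvPolynomial.coeff_sum, MvPolynomial.coeff_monomial] using h4

lemma coeff_eq_zero_of_value (f : H2 m E) (hf : ∀ z, value f z = 0) (k : Fin m → ℕ) :
    coeff f k = 0 := by
  refine ext_inner_left ℂ fun v => ?_
  rw [inner_zero_right]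
  refine hasSum_zero_imp (m := m) (α := fun k => inner ℂ v (coeff f k)) (fun z => ?_) k
  have := (innerSL ℂ v).hasSum (hasSum_value f z)
  rw [hf z] at this
  simpa [inner_smul_right] using this

/-- `H²_m ⊗ E` is a Hilbert space of `E`-valued functions on the ball. -/
instance : RKHS ℂ (H2 m E) (Ball m) E where
  coeCLM := ContinuousLinearMap.pi evalCLM
  coeCLM_injective := by
    refine (injective_iff_map_eq_zero _).2 fun f hf => ?_
    have h0 := coeff_eq_zero_of_value f (fun z => congrFun hf z)
    exact coeff_injective fun k => by
      rw [h0 k]; exact (smul_zero _).symm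

/-- `f(z) = ∑ a_k z^k`. -/
lemma hasSum_apply (f : H2 m E) (z : Ball m) :
    HasSum (fun k => monom z.1 k • coeff f k) (f z) := hasSum_value f z

/-- Every family `a` with `∑ ‖a_k‖² / γ_k < ∞` is the coefficient family of an element. -/
lemma exists_of_summable (a : (Fin m → ℕ) → E) (ha : Summable fun k => ‖a k‖ ^ 2 / γ k) :
    ∃ f : H2 m E, ∀ k, coeff f k = a k := by
  refine ⟨(⟨fun k => (√(γ k : ℝ))⁻¹ • a k, memℓp_gen (ha.congr fun k => ?_)⟩ :
    lp (fun _ : Fin m → ℕ => E) 2), fun k => smul_inv_smul₀ (sqrt_γ_pos k).ne' _⟩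
  have h : (0 : ℝ) < γ k := by exact_mod_cast γ_pos k
  rw [norm_smul, norm_inv, Real.norm_of_nonneg (sqrt_γ_pos k).le, ENNReal.toReal_ofNat,
    Real.rpow_ofNat, mul_pow, inv_pow, Real.sq_sqrt h.le]
  field_simp

/-- The reproducing kernel of `H²_m ⊗ E` is `(1 - ∑ z_i \bar w_i)⁻¹ I_E`. -/
lemma kernel_eq (z w : Ball m) :
    RKHS.kernel (H2 m E) z w =
      (1 - ∑ i, z.1 i * star (w.1 i))⁻¹ • ContinuousLinearMap.id ℂ E := by
  ext v
  obtain ⟨g, hg⟩ := exists_of_summable (fun k => ((γ k : ℂ) * star (monom w.1 k)) • v) (by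
    refine ((summable_sq_monom w).mul_right (‖v‖ ^ 2)).congr fun k => ?_
    have h : (0 : ℝ) < γ k := by exact_mod_cast γ_pos k
    rw [norm_smul, norm_mul, norm_star, mul_pow, mul_pow, Real.sq_sqrt h.le, mul_pow,
      RCLike.norm_natCast]
    field_simp)
  have hk : RKHS.kerFun (H2 m E) w v = g := by
    refine ext_inner_right ℂ fun f => ?_
    rw [RKHS.kerFun_inner]
    have h1 : HasSum (fun k => inner ℂ (normCoeff g k) (normCoeff f k)) (inner ℂ g f) :=
      lp.hasSum_inner (𝕜 := ℂ) (show lp (fun _ : Fin m → ℕ => E) 2 from g) f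
    have h2 := (innerSL ℂ v).hasSum (hasSum_apply f w)
    refine h2.unique ?_
    suffices h0 : ∀ k, inner ℂ (normCoeff g k) (normCoeff f k) =
        innerSL ℂ v (monom w.1 k • coeff f k) by
      simp only [h0] at h1
      exact h1
    intro k
    have h : (0 : ℝ) < γ k := by exact_mod_cast γ_pos k
    have h3 : normCoeff g k = (√(γ k : ℝ))⁻¹ • coeff g k :=
      (inv_smul_smul₀ (sqrt_γ_pos k).ne' _).symm
    have h4 : (γ k : ℂ) = (√(γ k : ℝ) : ℂ) * (√(γ k : ℝ) : ℂ) := by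
      rw [← Complex.ofReal_mul, Real.mul_self_sqrt h.le]; simp
    have h5 : (√(γ k : ℝ) : ℂ) ≠ 0 := by exact_mod_cast (sqrt_γ_pos k).ne'
    rw [h3, hg, coeff]
    simp only [innerSL_apply_apply, inner_smul_right, inner_smul_left, ← Complex.coe_smul, map_mul,
      Complex.conj_ofReal, h4, RCLike.star_def, Complex.conj_conj, Complex.ofReal_inv, map_inv₀]
    field_simp
  rw [← RKHS.kerFun_apply, hk]
  refine (hasSum_apply g z).unique ?_
  have := (hasSum_γ_mul (fun i => z.1 i * star (w.1 i)) (by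
    have h1 := sum_norm_sq_lt_one z
    have h2 := sum_norm_sq_lt_one w
    have h3 : ∀ i, ‖z.1 i * star (w.1 i)‖ ≤ (‖z.1 i‖ ^ 2 + ‖w.1 i‖ ^ 2) / 2 := by
      intro i
      rw [norm_mul, norm_star]
      nlinarith [sq_nonneg (‖z.1 i‖ - ‖w.1 i‖)]
    have h4 := Finset.sum_le_sum fun i (_ : i ∈ Finset.univ) => h3 i
    rw [← Finset.sum_div, Finset.sum_add_distrib] at h4
    linarith)).smul_const v
  suffices h0 : ∀ k, monom z.1 k • coeff g k =
      ((γ k : ℂ) * ∏ i, (z.1 i * star (w.1 i)) ^ k i) • v by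
    simp only [h0]
    exact this
  intro k
  rw [hg, smul_smul]
  simp only [monom, mul_pow, Finset.prod_mul_distrib, star_prod, star_pow]
  congr 1
  ring

/-- Multiplication by `z_i` maps `H²_m ⊗ E` to itself. -/
lemma exists_coord_mul (i : Fin m) (f : H2 m E) :
    ∃ g : H2 m E, ∀ z : Ball m, g z = z.1 i • f z := by
  have inj : Function.Injective fun k : Fin m → ℕ => k + Pi.single i 1 :=
    add_left_injective _
  have hγ : ∀ k : Fin m → ℕ, γ k ≤ γ (k + Pi.single i 1) := by
    intro k
    have h1 := Nat.multinomial_spec Finset.univ k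
    have h2 := Nat.multinomial_spec Finset.univ (k + Pi.single i 1)
    have h3 : ∑ j, (k + Pi.single i 1 : Fin m → ℕ) j = (∑ j, k j) + 1 := by
      simp [Finset.sum_add_distrib]
    have h4 : ∏ j, ((k + Pi.single i 1 : Fin m → ℕ) j).factorial = (k i + 1) * ∏ j, (k j).factorial := by
      rw [← Finset.mul_prod_erase _ _ (Finset.mem_univ i),
        ← Finset.mul_prod_erase Finset.univ (fun j => (k j).factorial) (Finset.mem_univ i)]
      have : ∀ j ∈ Finset.univ.erase i, ((k + Pi.single i 1 : Fin m → ℕ) j).factorial = (k j).factorial := by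
        intro j hj
        simp [Finset.ne_of_mem_erase hj]
      rw [Finset.prod_congr rfl this]
      simp [Nat.factorial_succ, mul_assoc]
    rw [h3, h4, Nat.factorial_succ, ← h1] at h2
    have h5 : k i ≤ ∑ j, k j := Finset.single_le_sum (fun _ _ => Nat.zero_le _) (Finset.mem_univ i)
    have h6 : 0 < ∏ j, (k j).factorial := Finset.prod_pos fun _ _ => Nat.factorial_pos _
    have h7 : (k i + 1) * γ (k + Pi.single i 1) = (∑ j, k j + 1) * γ k := by
      refine Nat.eq_of_mul_eq_mul_left h6 ?_
      rw [γ, γ]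
      linarith
    by_contra! h8
    nlinarith [γ_pos k]
  obtain ⟨g, hg⟩ := exists_of_summable
    (Function.extend (fun k : Fin m → ℕ => k + Pi.single i 1) (coeff f) 0) (by
      rw [← inj.summable_iff]
      · refine Summable.of_nonneg_of_le (fun k => ?_) (fun k => ?_) (norm_sq_eq f).summable
        · exact div_nonneg (sq_nonneg _) (Nat.cast_nonneg _)
        have h : (0 : ℝ) < γ k := by exact_mod_cast γ_pos k
        simp only [Function.comp_apply, inj.extend_apply]
        gcongr
        exact_mod_cast hγ k
      · intro k hk
        rw [Function.extend_apply' _ _ _ (by simpa using hk)]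
        simp)
  refine ⟨g, fun z => (hasSum_apply g z).unique ?_⟩
  rw [← inj.hasSum_iff]
  · convert (hasSum_apply f z).const_smul (z.1 i) using 2 with k
    simp only [Function.comp_apply, hg, inj.extend_apply, smul_smul]
    congr 1
    simp only [monom, Pi.add_apply, pow_add, Finset.prod_mul_distrib]
    rw [mul_comm, Finset.prod_eq_single i (by intro j _ hj; simp [hj]) (by simp)]
    simp
  · intro k hk
    rw [hg, Function.extend_apply' _ _ _ (by simpa using hk)]
    simp

end space

section multipliers

variable {m : ℕ} {E F : Type*} [NormedAddCommGroup E] [InnerProductSpace ℂ E] [CompleteSpace E]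
  [NormedAddCommGroup F] [InnerProductSpace ℂ F] [CompleteSpace F]

/-- Holomorphy of a function on the ball with values in a normed space. -/
def IsHolomorphic {V : Type*} [NormedAddCommGroup V] [NormedSpace ℂ V] (φ : Ball m → V) : Prop :=
  ∃ Φ : EuclideanSpace ℂ (Fin m) → V,
    DifferentiableOn ℂ Φ (Metric.ball 0 1) ∧ ∀ z : Ball m, Φ z = φ z

variable (m E F) in
/-- The multipliers `M(E, F)`: holomorphic functions `φ` on the ball with values in `L(E, F)`
such that `φ f ∈ H²_m ⊗ F` for all `f ∈ H²_m ⊗ E`. -/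
structure Multiplier where
  toFun : Ball m → E →L[ℂ] F
  holomorphic : IsHolomorphic toFun
  exists_mul : ∀ f : H2 m E, ∃ g : H2 m F, ∀ z, g z = toFun z (f z)

/-- The multiplication operator `M_φ f = φ f` as a linear map. -/
def mulLinear (φ : Multiplier m E F) : H2 m E →ₗ[ℂ] H2 m F where
  toFun f := (φ.exists_mul f).choose
  map_add' f g := RKHS.ext fun z => by
    have h1 := (φ.exists_mul (f + g)).choose_spec z
    have h2 := (φ.exists_mul f).choose_spec z
    have h3 := (φ.exists_mul g).choose_spec z
    refine h1.trans ?_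
    rw [RKHS.coe_add, RKHS.coe_add, Pi.add_apply, Pi.add_apply, map_add, h2, h3]
  map_smul' c f := RKHS.ext fun z => by
    have h1 := (φ.exists_mul (c • f)).choose_spec z
    have h2 := (φ.exists_mul f).choose_spec z
    refine h1.trans ?_
    rw [RingHom.id_apply, RKHS.coe_smul, RKHS.coe_smul, Pi.smul_apply, Pi.smul_apply, map_smul, h2]

lemma mulLinear_apply (φ : Multiplier m E F) (f : H2 m E) (z : Ball m) :
    mulLinear φ f z = φ.toFun z (f z) := (φ.exists_mul f).choose_spec z

lemma isClosed_graph_mulLinear (φ : Multiplier m E F) :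
    IsClosed ((mulLinear φ).graph : Set (H2 m E × H2 m F)) := by
  have : ((mulLinear φ).graph : Set (H2 m E × H2 m F)) =
      ⋂ z : Ball m, {x | x.2 z = φ.toFun z (x.1 z)} := by
    ext x
    simp only [SetLike.mem_coe, LinearMap.mem_graph_iff, Set.mem_iInter, Set.mem_ofPred_eq]
    refine ⟨fun h z => by rw [h, mulLinear_apply], fun h => RKHS.ext fun z => ?_⟩
    rw [h z, mulLinear_apply]
  rw [this]
  refine isClosed_iInter fun z => isClosed_eq ?_ ?_
  · exact (RKHS.continuous_eval (𝕜 := ℂ) z).comp continuous_snd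
  · exact (φ.toFun z).continuous.comp ((RKHS.continuous_eval (𝕜 := ℂ) z).comp continuous_fst)

/-- The bounded multiplication operator `M_φ : H²_m ⊗ E → H²_m ⊗ F`, `M_φ f = φ f`. -/
def M (φ : Multiplier m E F) : H2 m E →L[ℂ] H2 m F :=
  ContinuousLinearMap.ofIsClosedGraph (isClosed_graph_mulLinear φ)

lemma M_apply (φ : Multiplier m E F) (f : H2 m E) (z : Ball m) :
    M φ f z = φ.toFun z (f z) := mulLinear_apply φ f z

variable (E) in
/-- The coordinate function `z_i I_E` as a multiplier. -/
def coord (i : Fin m) : Multiplier m E E where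
  toFun z := z.1 i • ContinuousLinearMap.id ℂ E
  holomorphic := ⟨fun z => z i • ContinuousLinearMap.id ℂ E, by fun_prop, fun _ => rfl⟩
  exists_mul f := exists_coord_mul i f

/-- A (closed) submodule of the Hilbert module `H²_m ⊗ E` over `ℂ[z_1, …, z_m]`, where the
variables act by the coordinate multiplications `M_{z_i} ⊗ I_E`. -/
structure IsClosedSubmodule (S : Submodule ℂ (H2 m E)) : Prop where
  isClosed : IsClosed (S : Set (H2 m E))
  coord_mem : ∀ i : Fin m, ∀ f ∈ S, M (coord E i) f ∈ S

end multipliers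

end DruryArveson

end

noncomputable section
namespace DruryArveson
open ContinuousLinearMap Filter Topology

variable {m : ℕ} {E F : Type*} [NormedAddCommGroup E] [InnerProductSpace ℂ E] [CompleteSpace E]
  [NormedAddCommGroup F] [InnerProductSpace ℂ F] [CompleteSpace F]

/-! If `M θ ∘L M ψ ∘L M θ = M θ`, then `M θ ∘L M ψ` is an idempotent module map with the same range
as `M θ`, and its kernel is the complement. Conversely, let `P` be the projection onto the range
along `S`. By the open mapping theorem `P = M θ ∘L C` with `C` bounded (`exists_lift_of_isCompl`),
and `P` commutes with the shifts, although `C` need not. Since `P* = C* (M θ)*`, we have `‖P* h‖ ≤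
‖C‖ ‖(M θ)* h‖`, and Leech's theorem (`exists_comp_eq_of_norm_adjoint_le`) replaces `C` by a
multiplication operator: `P = M θ ∘L M ψ`. Applying both sides to the range of `M θ` gives the
claim.

Leech's theorem is proved by a lurking contraction. With `D² = AA* - BB*`, the identity `‖f‖² =
‖f(0)‖² + ∑ ‖M_{z_i}* f‖²` turns the intertwining relations into an isometry `(A*h(0), (D M_{z_i}*
h)_i) ↦ (B*h(0), D h)`. The blocks of a contractive extension define a recursive operator equation,
which is solvable because the shifts form a row contraction (`exists_eq_add_sum`) and has only one
solution (`eq_zero_of_eq_sum`). The adjoint of one component of the solution is the desired factor;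
its recursion identifies it as a multiplication operator (`exists_multiplier`). -/

/-- The centre of the ball. -/
def center (m : ℕ) : Ball m := ⟨0, Metric.mem_ball_self one_pos⟩

/-! ### Shifts, backward shifts and kernel functions. -/

variable (E) in
/-- The coordinate shift `M_{z_i}`. -/
abbrev shift (i : Fin m) : H2 m E →L[ℂ] H2 m E := M (coord E i)

variable (E) in
/-- The adjoint `M_{z_i}^*` of the coordinate shift. -/
abbrev backShift (i : Fin m) : H2 m E →L[ℂ] H2 m E := (M (coord E i)).adjoint

variable (E) in
/-- The kernel functions `v ↦ k_w v`. -/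
abbrev ker (w : Ball m) : E →L[ℂ] H2 m E := RKHS.kerFun (H2 m E) w

lemma apply_smul (c : ℂ) (f : H2 m E) (z : Ball m) : (c • f) z = c • f z := by
  rw [RKHS.coe_smul, Pi.smul_apply]

lemma apply_add (f g : H2 m E) (z : Ball m) : (f + g) z = f z + g z := by
  rw [RKHS.coe_add, Pi.add_apply]

lemma apply_sum {ι : Type*} (s : Finset ι) (f : ι → H2 m E) (z : Ball m) :
    (∑ i ∈ s, f i) z = ∑ i ∈ s, f i z := by
  simpa only [RKHS.adjoint_kerFun] using map_sum (ker E z).adjoint f s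

lemma shift_apply (i : Fin m) (f : H2 m E) (z : Ball m) : shift E i f z = z.1 i • f z := by
  rw [M_apply]; rfl

lemma kerFun_eq (z w : Ball m) (v : E) :
    ker E w v z = (1 - ∑ i, z.1 i * star (w.1 i))⁻¹ • v := by
  rw [RKHS.kerFun_apply, kernel_eq]; rfl

lemma kerFun_center (z : Ball m) (v : E) : ker E (center m) v z = v := by
  rw [kerFun_eq]; simp [center]

lemma kerFun_apply_center (w : Ball m) (v : E) : ker E w v (center m) = v := by
  rw [kerFun_eq]; simp [center]

lemma norm_sum_mul_star_lt (z w : Ball m) : ‖∑ i, z.1 i * star (w.1 i)‖ < 1 := by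
  have h1 := sum_norm_sq_lt_one z
  have h2 := sum_norm_sq_lt_one w
  have h3 : ∀ i, ‖z.1 i * star (w.1 i)‖ ≤ (‖z.1 i‖ ^ 2 + ‖w.1 i‖ ^ 2) / 2 := by
    intro i
    rw [norm_mul, norm_star]
    nlinarith [sq_nonneg (‖z.1 i‖ - ‖w.1 i‖)]
  have h4 := Finset.sum_le_sum fun i (_ : i ∈ Finset.univ) => h3 i
  rw [← Finset.sum_div, Finset.sum_add_distrib] at h4
  have h5 := norm_sum_le Finset.univ fun i => z.1 i * star (w.1 i)
  linarith

lemma one_sub_sum_mul_star_ne_zero (z w : Ball m) : 1 - ∑ i, z.1 i * star (w.1 i) ≠ 0 := by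
  intro h
  have h1 := norm_sum_mul_star_lt z w
  rw [← sub_eq_zero.1 h, norm_one] at h1
  exact lt_irrefl _ h1

/-- Joint eigenvectors of the backward shifts: on them, operator recursions become scalar ones. -/
lemma backShift_kerFun (i : Fin m) (w : Ball m) (v : E) :
    backShift E i (ker E w v) = star (w.1 i) • ker E w v := by
  refine ext_inner_right ℂ fun f => ?_
  rw [adjoint_inner_left, RKHS.kerFun_inner, shift_apply, inner_smul_left, RKHS.kerFun_inner,
    inner_smul_right]
  simp

/-- This is `1 + s / (1 - s) = 1 / (1 - s)` for `s = ∑ z_i \bar w_i`. -/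
lemma kerFun_center_add_sum (w : Ball m) (v : E) :
    ker E (center m) v + ∑ i, star (w.1 i) • shift E i (ker E w v) = ker E w v := by
  refine RKHS.ext fun z => ?_
  rw [apply_add, apply_sum, kerFun_center]
  simp only [apply_smul, shift_apply, smul_smul]
  rw [← Finset.sum_smul, kerFun_eq, smul_smul]
  nth_rw 1 [← one_smul ℂ v]
  rw [← add_smul]
  congr 1
  have h := one_sub_sum_mul_star_ne_zero z w
  rw [show ∑ i, star (w.1 i) * z.1 i = ∑ i, z.1 i * star (w.1 i) from
    Finset.sum_congr rfl fun _ _ => mul_comm _ _]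
  field_simp
  ring

/-- Operators that agree on kernel functions are equal. -/
lemma ext_kerFun {V : Type*} [NormedAddCommGroup V] [NormedSpace ℂ V] {S T : H2 m E →L[ℂ] V}
    (h : ∀ w v, S (ker E w v) = T (ker E w v)) : S = T := by
  have hd : Dense ((Submodule.span ℂ {ker E w v | (w) (v)} : Submodule ℂ (H2 m E)) : Set (H2 m E)) := by
    rw [Submodule.dense_iff_topologicalClosure_eq_top]
    exact RKHS.kerFun_dense (H2 m E)
  refine ContinuousLinearMap.ext_on hd ?_
  rintro _ ⟨w, v, rfl⟩
  exact h w v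

/-! ### The shift tuple as a row contraction. -/

/-- `I - ∑ M_{z_i} M_{z_i}^*` is the projection onto the constants. -/
lemma eq_add_sum_shift_backShift (f : H2 m E) :
    ker E (center m) (f (center m)) + ∑ i, shift E i (backShift E i f) = f := by
  have : ker E (center m) ∘L (ker E (center m)).adjoint + ∑ i, shift E i ∘L backShift E i =
      ContinuousLinearMap.id ℂ _ := by
    refine ext_kerFun fun w v => ?_
    rw [add_apply, sum_apply]
    simp only [comp_apply, RKHS.adjoint_kerFun, backShift_kerFun, map_smul, kerFun_apply_center,
      kerFun_center_add_sum, id_apply]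
  simpa only [add_apply, sum_apply, comp_apply, RKHS.adjoint_kerFun, id_apply] using
    congrArg (fun T => T f) this

lemma inner_shift (i : Fin m) (f g : H2 m E) :
    inner ℂ (shift E i f) g = inner ℂ f (backShift E i g) := (adjoint_inner_right _ _ _).symm

/-- Pair the decomposition `eq_add_sum_shift_backShift` with `f` itself. -/
lemma norm_sq_eq_add_sum (f : H2 m E) :
    ‖f‖ ^ 2 = ‖f (center m)‖ ^ 2 + ∑ i, ‖backShift E i f‖ ^ 2 := by
  have h := congrArg (fun g => RCLike.re (inner ℂ g f)) (eq_add_sum_shift_backShift f)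
  simp only [inner_add_left, sum_inner, RKHS.kerFun_inner, inner_shift,
    map_add, map_sum, inner_self_eq_norm_sq] at h
  exact h.symm

lemma re_inner_le {E : Type*} [NormedAddCommGroup E] [InnerProductSpace ℂ E] (v w : E) : RCLike.re (inner ℂ v w) ≤ (‖v‖ ^ 2 + ‖w‖ ^ 2) / 2 := by
  have := re_inner_le_norm (𝕜 := ℂ) v w
  nlinarith [sq_nonneg (‖v‖ - ‖w‖)]

/-- The row `(k_0, M_{z_1}, …, M_{z_m})` is a contraction. -/
lemma norm_sq_row_le (v : E) (f : Fin m → H2 m E) :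
    ‖ker E (center m) v + ∑ i, shift E i (f i)‖ ^ 2 ≤ ‖v‖ ^ 2 + ∑ i, ‖f i‖ ^ 2 := by
  set x := ker E (center m) v + ∑ i, shift E i (f i) with hx
  -- Estimating each inner product by half the sum of squares produces `‖x‖² / 2` on the right, by
  -- `norm_sq_eq_add_sum`, and this is absorbed on the left.
  have h1 : ‖x‖ ^ 2 = RCLike.re (inner ℂ v (x (center m))) +
      ∑ i, RCLike.re (inner ℂ (f i) (backShift E i x)) := by
    rw [← inner_self_eq_norm_sq (𝕜 := ℂ)]
    nth_rw 1 [hx]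
    simp only [inner_add_left, sum_inner, RKHS.kerFun_inner, inner_shift,
      map_add, map_sum]
  have h2 := re_inner_le v (x (center m))
  have h3 := Finset.sum_le_sum fun i (_ : i ∈ Finset.univ) => re_inner_le (f i) (backShift E i x)
  rw [← Finset.sum_div, Finset.sum_add_distrib] at h3
  have h4 := norm_sq_eq_add_sum x
  linarith

/-! ### The recursive equation `T f = U₀ f(0) + ∑ U_i T M_{z_i}^* f`. -/

section iteration

variable {Z : Type*} [NormedAddCommGroup Z] [NormedSpace ℂ Z]

lemma norm_sum_smul_le {U : Fin m → Z →L[ℂ] Z}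
    (hU : ∀ x : Fin m → Z, ‖∑ i, U i (x i)‖ ^ 2 ≤ ∑ i, ‖x i‖ ^ 2)
    (w : EuclideanSpace ℂ (Fin m)) (x : Z) : ‖∑ i, w i • U i x‖ ≤ ‖w‖ * ‖x‖ := by
  have h := hU fun i => w i • x
  simp only [map_smul, norm_smul, mul_pow] at h
  rw [← Finset.sum_mul, ← EuclideanSpace.norm_sq_eq, ← mul_pow] at h
  exact le_of_sq_le_sq h (by positivity)

lemma norm_star_ball (w : Ball m) :
    ‖(WithLp.toLp 2 fun i => star (w.1 i) : EuclideanSpace ℂ (Fin m))‖ < 1 := by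
  have := w.2
  rw [mem_ball_zero_iff, EuclideanSpace.norm_eq] at this
  simpa [EuclideanSpace.norm_eq] using this

/-- On a kernel function at `w` the equation reads `x = ∑ \bar w_i U_i x`, so `‖x‖ ≤ ‖w‖ ‖x‖` with
`‖w‖ < 1`. -/
lemma eq_zero_of_eq_sum {U : Fin m → Z →L[ℂ] Z}
    (hU : ∀ x : Fin m → Z, ‖∑ i, U i (x i)‖ ^ 2 ≤ ∑ i, ‖x i‖ ^ 2)
    {T : H2 m E →L[ℂ] Z} (hT : ∀ f, T f = ∑ i, U i (T (backShift E i f))) : T = 0 := by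
  refine ext_kerFun fun w v => ?_
  have h := hT (ker E w v)
  simp only [backShift_kerFun, map_smul] at h
  have h2 := norm_sum_smul_le hU (WithLp.toLp 2 fun i => star (w.1 i)) (T (ker E w v))
  have h3 := norm_star_ball w
  simp only at h2
  rw [← h] at h2
  rw [zero_apply, ← norm_eq_zero]
  nlinarith [norm_nonneg (T (ker E w v))]

/-- Picard iteration from `0`. The iterates need not converge in norm, but they are all contractions
and converge geometrically on kernel functions, hence strongly. -/
lemma exists_eq_add_sum [CompleteSpace Z] (U₀ : E →L[ℂ] Z) (U : Fin m → Z →L[ℂ] Z)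
    (hU : ∀ e (x : Fin m → Z), ‖U₀ e + ∑ i, U i (x i)‖ ^ 2 ≤ ‖e‖ ^ 2 + ∑ i, ‖x i‖ ^ 2) :
    ∃ T : H2 m E →L[ℂ] Z, ∀ f, T f = U₀ (f (center m)) + ∑ i, U i (T (backShift E i f)) := by
  have hU' : ∀ x : Fin m → Z, ‖∑ i, U i (x i)‖ ^ 2 ≤ ∑ i, ‖x i‖ ^ 2 := by
    intro x; simpa using hU 0 x
  let t : ℕ → H2 m E →L[ℂ] Z := fun n => Nat.rec 0
    (fun _ T => U₀ ∘L (ker E (center m)).adjoint + ∑ i, U i ∘L T ∘L backShift E i) n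
  have ht : ∀ n f, t (n + 1) f = U₀ (f (center m)) + ∑ i, U i (t n (backShift E i f)) := by
    intro n f
    simp only [t, add_apply, comp_apply, sum_apply, RKHS.adjoint_kerFun]
  have hb : ∀ n f, ‖t n f‖ ≤ ‖f‖ := by
    intro n
    induction n with
    | zero => intro f; simp [t]
    | succ n ih =>
      intro f
      refine le_of_sq_le_sq ?_ (norm_nonneg _)
      rw [ht, norm_sq_eq_add_sum f]
      refine (hU _ _).trans ?_
      gcongr
      exact ih _
  have hker : ∀ w v, CauchySeq fun n => t n (ker E w v) := by
    intro w v
    have hw := norm_star_ball w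
    set r := ‖(WithLp.toLp 2 fun i => star (w.1 i) : EuclideanSpace ℂ (Fin m))‖
    refine cauchySeq_of_le_geometric r (dist (t 0 (ker E w v)) (t 1 (ker E w v))) hw fun n => ?_
    induction n with
    | zero => simp
    | succ n ih =>
      have h2 := norm_sum_smul_le hU' (WithLp.toLp 2 fun i => star (w.1 i))
        (t n (ker E w v) - t (n + 1) (ker E w v))
      have h3 : t (n + 1) (ker E w v) - t (n + 1 + 1) (ker E w v) =
          ∑ i, star (w.1 i) • U i (t n (ker E w v) - t (n + 1) (ker E w v)) := by
        rw [ht (n + 1)]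
        nth_rw 1 [ht n]
        simp only [backShift_kerFun, map_smul, map_sub, smul_sub, Finset.sum_sub_distrib]
        exact add_sub_add_left_eq_sub _ _ _
      rw [dist_eq_norm, h3, pow_succ, ← mul_assoc, mul_comm]
      rw [dist_eq_norm] at ih
      refine h2.trans ?_
      exact mul_le_mul_of_nonneg_left ih (norm_nonneg _)
  -- The vectors of convergence form a subspace, closed thanks to the uniform bound `hb`, which
  -- contains the total set of kernel functions.
  let C : Submodule ℂ (H2 m E) :=
    { carrier := {f | CauchySeq fun n => t n f}
      zero_mem' := by simpa using cauchySeq_const (0 : Z)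
      add_mem' := fun {a b} ha hb => by simpa using! CauchySeq.add ha hb
      smul_mem' := fun c f hf => by
        simpa using! (uniformContinuous_const_smul c).comp_cauchySeq hf }
  have hC : IsClosed (C : Set (H2 m E)) := by
    refine isClosed_of_closure_subset fun f hf => ?_
    refine Metric.cauchySeq_iff.2 fun ε hε => ?_
    obtain ⟨g, hg, hfg⟩ := Metric.mem_closure_iff.1 hf (ε / 3) (by positivity)
    obtain ⟨N, hN⟩ := Metric.cauchySeq_iff.1 hg (ε / 3) (by positivity)
    refine ⟨N, fun a ha b hb' => ?_⟩
    have h1 := hN a ha b hb'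
    have h2 := hb a (f - g)
    have h3 := hb b (f - g)
    rw [dist_eq_norm] at hfg
    rw [map_sub, ← dist_eq_norm] at h2 h3
    have h4 := dist_triangle4 (t a f) (t a g) (t b g) (t b f)
    rw [dist_comm (t b g)] at h4
    linarith
  have htop : ∀ f, CauchySeq fun n => t n f := by
    intro f
    have h1 : Submodule.span ℂ {ker E w v | (w) (v)} ≤ C := by
      refine Submodule.span_le.2 ?_
      rintro _ ⟨w, v, rfl⟩
      exact hker w v
    have h2 := Submodule.topologicalClosure_minimal _ h1 hC
    rw [RKHS.kerFun_dense] at h2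
    exact h2 Submodule.mem_top
  choose l hl using fun f => cauchySeq_tendsto_of_complete (htop f)
  refine ⟨continuousLinearMapOfTendsto t (tendsto_pi_nhds.2 hl), fun f => ?_⟩
  refine tendsto_nhds_unique ((tendsto_add_atTop_iff_nat 1).2 (hl f)) ?_
  simp only [ht]
  refine tendsto_const_nhds.add (tendsto_finsetSum _ fun i _ => ?_)
  exact ((U i).continuous.tendsto _).comp (hl _)

end iteration

/-! ### Recognizing multiplication operators. -/

/-- `(1 - ∑ z_i M_{z_i}^*)⁻¹` exists on the ball. -/
lemma isUnit_one_sub_sum_backShift {z : EuclideanSpace ℂ (Fin m)} (hz : z ∈ Metric.ball 0 1) :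
    IsUnit (1 - ∑ i, z i • backShift E i : H2 m E →L[ℂ] H2 m E) := by
  refine isUnit_one_sub_of_norm_lt_one ?_
  -- The row bound concerns the forward shifts, so the norm is estimated on the adjoint.
  have h0 : (∑ i, z i • backShift E i : H2 m E →L[ℂ] H2 m E) =
      (∑ i, star (z i) • shift E i : H2 m E →L[ℂ] H2 m E).adjoint := by
    rw [map_sum]
    simp only [map_smulₛₗ, RCLike.star_def, Complex.conj_conj]
  rw [h0, LinearIsometryEquiv.norm_map]
  refine lt_of_le_of_lt (opNorm_le_bound _ (norm_nonneg _) fun f => ?_)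
    (norm_star_ball ⟨z, hz⟩)
  have := norm_sum_smul_le (U := fun i => shift E i)
    (fun x => by simpa using norm_sq_row_le (0 : E) x)
    (WithLp.toLp 2 fun i => star (z i)) f
  simpa using this

/-- Evaluation at `z` written through a resolvent, so that it depends holomorphically on `z` in
operator norm. -/
lemma adjoint_kerFun_eq (z : Ball m) : (ker E z).adjoint =
    (ker E (center m)).adjoint ∘L Ring.inverse (1 - ∑ i, z.1 i • backShift E i) := by
  have h : (ker E z).adjoint ∘L (1 - ∑ i, z.1 i • backShift E i) =
      (ker E (center m)).adjoint := by
    refine ext_kerFun fun w v => ?_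
    have h0 := one_sub_sum_mul_star_ne_zero z w
    simp only [comp_apply, sub_apply, one_apply_eq_self, sum_apply, smul_apply, backShift_kerFun,
      RKHS.adjoint_kerFun, smul_smul, kerFun_apply_center, ← Finset.sum_smul]
    rw [RKHS.coe_sub, Pi.sub_apply, apply_smul, kerFun_eq, smul_smul, ← sub_smul, ← one_sub_mul,
      mul_inv_cancel₀ h0, one_smul]
  rw [← h, comp_assoc, ← mul_def, Ring.mul_inverse_cancel _ (isUnit_one_sub_sum_backShift z.2)]
  rfl

/-- An operator `X` with `X f = Y f(0) + ∑ M_{z_i} X M_{z_i}^* f` is a multiplication operator. -/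
lemma exists_multiplier (X : H2 m F →L[ℂ] H2 m E) (Y : F →L[ℂ] H2 m E)
    (hX : ∀ f, X f = Y (f (center m)) + ∑ i, shift E i (X (backShift F i f))) :
    ∃ ψ : Multiplier m F E, M ψ = X := by
  -- At a kernel function, `hX` evaluated at `z` says `(1 - ∑ z_i \bar w_i) X(k_w v)(z) = (Y v)(z)`.
  -- So the symbol is `ψ(z) v = (Y v)(z)`.
  have key : ∀ z f, X f z = Y (f z) z := by
    intro z
    have : (ker E z).adjoint ∘L X = (ker E z).adjoint ∘L Y ∘L (ker F z).adjoint := by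
      refine ext_kerFun fun w v => ?_
      have h := congrArg (fun g : H2 m E => g z) (hX (ker F w v))
      simp only [backShift_kerFun, map_smul, kerFun_apply_center, apply_add, apply_sum,
        apply_smul, shift_apply, smul_smul] at h
      rw [← Finset.sum_smul] at h
      simp only [comp_apply, RKHS.adjoint_kerFun]
      rw [kerFun_eq, map_smul, apply_smul, eq_inv_smul_iff₀ (one_sub_sum_mul_star_ne_zero z w),
        sub_smul, one_smul, sub_eq_iff_eq_add]
      simpa only [mul_comm] using h
    intro f
    simpa only [comp_apply, RKHS.adjoint_kerFun] using congrArg (fun T => T f) this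
  refine ⟨⟨fun z => (ker E z).adjoint ∘L Y, ⟨fun z => (ker E (center m)).adjoint ∘L
    Ring.inverse (1 - ∑ i, z i • backShift E i) ∘L Y, ?_, ?_⟩, ?_⟩, ?_⟩
  · intro z hz
    have h1 : DifferentiableAt ℂ (fun z : EuclideanSpace ℂ (Fin m) =>
        (1 - ∑ i, z i • backShift E i : H2 m E →L[ℂ] H2 m E)) z := by fun_prop
    have h2 := h1.inverse (isUnit_one_sub_sum_backShift hz)
    have h3 : DifferentiableAt ℂ (fun z : EuclideanSpace ℂ (Fin m) =>
      (ker E (center m)).adjoint ∘L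
        Ring.inverse (1 - ∑ i, z i • backShift E i : H2 m E →L[ℂ] H2 m E) ∘L Y) z :=
      (differentiableAt_const _).clm_comp (h2.clm_comp (differentiableAt_const _))
    exact h3.differentiableWithinAt
  · intro z
    change _ = (ker E z).adjoint ∘L Y
    rw [adjoint_kerFun_eq z]; rfl
  · intro f
    exact ⟨X f, fun z => by simpa using key z f⟩
  · ext1 f
    refine RKHS.ext fun z => ?_
    rw [M_apply, key]
    simp

/-! ### Leech's theorem by a lurking contraction. -/

/-- Douglas' factorization of one operator through another. -/
lemma exists_comp_eq_of_norm_le {H K L : Type*} [NormedAddCommGroup H] [InnerProductSpace ℂ H]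
    [NormedAddCommGroup K] [InnerProductSpace ℂ K] [CompleteSpace K]
    [NormedAddCommGroup L] [InnerProductSpace ℂ L] [CompleteSpace L]
    (S : H →L[ℂ] K) (T : H →L[ℂ] L) (h : ∀ x, ‖T x‖ ≤ ‖S x‖) :
    ∃ V : K →L[ℂ] L, (∀ y, ‖V y‖ ≤ ‖y‖) ∧ ∀ x, V (S x) = T x := by
  let R : Submodule ℂ K := S.range.topologicalClosure
  have hR : ∀ x, S x ∈ R := fun x => Submodule.le_topologicalClosure _ ⟨x, rfl⟩
  let e : H →ₗ[ℂ] R := S.toLinearMap.codRestrict R hR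
  have he : DenseRange e := by
    intro y
    rw [closure_subtype, ← Set.range_comp]
    exact y.2
  have hn : ∀ x, ‖T.toLinearMap x‖ ≤ 1 * ‖e x‖ := by
    intro x; simpa using! h x
  have : CompleteSpace R := (Submodule.isClosed_topologicalClosure _).completeSpace_coe
  let W : R →L[ℂ] L := T.toLinearMap.extendOfNorm e
  have hW : ∀ y, ‖W y‖ ≤ ‖y‖ := by
    intro y
    simpa using LinearMap.norm_extendOfNorm_apply_le he 1 hn y
  -- `W` extends `S x ↦ T x` to the closed range of `S`; the orthogonal complement is sent to `0`.
  refine ⟨W ∘L R.orthogonalProjectionOnto, fun y => (hW _).trans ?_, fun x => ?_⟩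
  · exact R.norm_orthogonalProjectionOnto_apply_le y
  · have h1 : R.orthogonalProjectionOnto (S x) = e x :=
      Submodule.orthogonalProjectionOnto_mem_subspace_eq_self (e x)
    rw [comp_apply, h1]
    exact LinearMap.extendOfNorm_eq he ⟨1, hn⟩ x

/-- The defect operator of `‖T x‖ ≤ ‖S x‖`. -/
lemma exists_defect {H K L : Type*} [NormedAddCommGroup H] [InnerProductSpace ℂ H]
    [CompleteSpace H]
    [NormedAddCommGroup K] [InnerProductSpace ℂ K] [CompleteSpace K]
    [NormedAddCommGroup L] [InnerProductSpace ℂ L] [CompleteSpace L]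
    (S : H →L[ℂ] K) (T : H →L[ℂ] L) (h : ∀ x, ‖T x‖ ≤ ‖S x‖) :
    ∃ D : H →L[ℂ] H, ∀ x, ‖D x‖ ^ 2 + ‖T x‖ ^ 2 = ‖S x‖ ^ 2 := by
  let Q : H →L[ℂ] H := S.adjoint ∘L S - T.adjoint ∘L T
  have hre : ∀ x, RCLike.re (inner ℂ (Q x) x) = ‖S x‖ ^ 2 - ‖T x‖ ^ 2 := by
    intro x
    simp only [Q, sub_apply, comp_apply, inner_sub_left, adjoint_inner_left, map_sub,
      inner_self_eq_norm_sq]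
  have hQ : 0 ≤ Q := by
    rw [nonneg_iff_isPositive, isPositive_def']
    refine ⟨?_, fun x => ?_⟩
    · simp [Q, IsSelfAdjoint, star_eq_adjoint, adjoint_comp]
    · rw [reApplyInnerSelf_apply, hre]
      have := pow_le_pow_left₀ (norm_nonneg _) (h x) 2
      linarith
  have hsa : IsSelfAdjoint (CFC.sqrt Q) := (CFC.sqrt_nonneg Q).isSelfAdjoint
  refine ⟨CFC.sqrt Q, fun x => ?_⟩
  have h1 : ‖CFC.sqrt Q x‖ ^ 2 = RCLike.re (inner ℂ (Q x) x) := by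
    rw [← inner_self_eq_norm_sq (𝕜 := ℂ), ← adjoint_inner_left, ← star_eq_adjoint, hsa.star_eq,
      show (CFC.sqrt Q) ((CFC.sqrt Q) x) = (CFC.sqrt Q * CFC.sqrt Q) x from rfl, CFC.sqrt_mul_sqrt_self Q hQ]
  rw [h1, hre]
  ring

/-- Leech's factorization theorem on the Drury-Arveson space. -/
theorem exists_comp_eq_of_norm_adjoint_le {G : Type*} [NormedAddCommGroup G]
    [InnerProductSpace ℂ G] [CompleteSpace G]
    (A : H2 m E →L[ℂ] H2 m G) (B : H2 m F →L[ℂ] H2 m G)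
    (hA : ∀ i f, A (shift E i f) = shift G i (A f))
    (hB : ∀ i f, B (shift F i f) = shift G i (B f))
    (hAB : ∀ h, ‖B.adjoint h‖ ≤ ‖A.adjoint h‖) :
    ∃ (X : H2 m F →L[ℂ] H2 m E) (Y : F →L[ℂ] H2 m E), A ∘L X = B ∧
      ∀ f, X f = Y (f (center m)) + ∑ i, shift E i (X (backShift F i f)) := by
  have hA' : ∀ i h, A.adjoint (backShift G i h) = backShift E i (A.adjoint h) := by
    intro i h
    have : A ∘L shift E i = shift G i ∘L A := ContinuousLinearMap.ext (hA i)
    have := congrArg (fun T => adjoint T h) this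
    simpa only [adjoint_comp, comp_apply] using this.symm
  have hB' : ∀ i h, B.adjoint (backShift G i h) = backShift F i (B.adjoint h) := by
    intro i h
    have : B ∘L shift F i = shift G i ∘L B := ContinuousLinearMap.ext (hB i)
    have := congrArg (fun T => adjoint T h) this
    simpa only [adjoint_comp, comp_apply] using this.symm
  obtain ⟨D, hD⟩ := exists_defect A.adjoint B.adjoint hAB
  -- `S h` and `T h` have equal norms: expand `‖A*h‖² = ‖B*h‖² + ‖D h‖²` by `norm_sq_eq_add_sum` and
  -- subtract the same identity at each `M_{z_i}* h`.
  let S : H2 m G →L[ℂ] WithLp 2 (E × PiLp 2 fun _ : Fin m => H2 m G) :=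
    (WithLp.prodContinuousLinearEquiv 2 ℂ E (PiLp 2 fun _ : Fin m => H2 m G)).symm.toContinuousLinearMap ∘L
      (((ker E (center m)).adjoint ∘L A.adjoint).prod
        ((PiLp.continuousLinearEquiv 2 ℂ fun _ : Fin m => H2 m G).symm.toContinuousLinearMap ∘L
          ContinuousLinearMap.pi fun i => D ∘L backShift G i))
  let T : H2 m G →L[ℂ] WithLp 2 (F × H2 m G) :=
    (WithLp.prodContinuousLinearEquiv 2 ℂ F (H2 m G)).symm.toContinuousLinearMap ∘L
      (((ker F (center m)).adjoint ∘L B.adjoint).prod D)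
  have hS : ∀ h, ‖S h‖ ^ 2 = ‖A.adjoint h (center m)‖ ^ 2 + ∑ i, ‖D (backShift G i h)‖ ^ 2 := by
    intro h
    rw [WithLp.prod_norm_sq_eq_of_L2, PiLp.norm_sq_eq_of_L2]
    simp [S]
  have hT : ∀ h, ‖T h‖ ^ 2 = ‖B.adjoint h (center m)‖ ^ 2 + ‖D h‖ ^ 2 := by
    intro h
    rw [WithLp.prod_norm_sq_eq_of_L2]
    simp [T]
  obtain ⟨V, hV, hVS⟩ := exists_comp_eq_of_norm_le S T (fun h => by
    refine le_of_sq_le_sq ?_ (norm_nonneg _)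
    rw [hS, hT]
    have h1 := norm_sq_eq_add_sum (A.adjoint h)
    have h2 := norm_sq_eq_add_sum (B.adjoint h)
    have h3 := hD h
    have h4 := Finset.sum_congr rfl fun i (_ : i ∈ Finset.univ) => hD (backShift G i h)
    simp only [hA', hB', Finset.sum_add_distrib] at h4
    linarith)
  let inl : E →L[ℂ] WithLp 2 (E × PiLp 2 fun _ : Fin m => H2 m G) :=
    (WithLp.prodContinuousLinearEquiv 2 ℂ E (PiLp 2 fun _ : Fin m => H2 m G)).symm.toContinuousLinearMap ∘L
      ContinuousLinearMap.inl ℂ _ _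
  let inr : (i : Fin m) → H2 m G →L[ℂ] WithLp 2 (E × PiLp 2 fun _ : Fin m => H2 m G) := fun i =>
    (WithLp.prodContinuousLinearEquiv 2 ℂ E (PiLp 2 fun _ : Fin m => H2 m G)).symm.toContinuousLinearMap ∘L
      ContinuousLinearMap.inr ℂ _ _ ∘L
        (PiLp.continuousLinearEquiv 2 ℂ fun _ : Fin m => H2 m G).symm.toContinuousLinearMap ∘L
          ContinuousLinearMap.single ℂ (fun _ : Fin m => H2 m G) i
  have hsum : ∀ e (x : Fin m → H2 m G), inl e + ∑ i, inr i (x i) =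
      WithLp.toLp 2 (e, WithLp.toLp 2 x) := by
    intro e x
    have hx : x = ∑ i, Pi.single i (x i) := (Finset.univ_sum_single x).symm
    simp only [inl, inr, comp_apply, ContinuousLinearEquiv.coe_coe]
    simp only [← map_sum, ← map_add, ContinuousLinearMap.single_apply, ← hx]
    simp
  -- The block entries of `V`, a contraction from `E ⊕ (H2 m G)^m` to `F ⊕ H2 m G`.
  let a : E →L[ℂ] F := WithLp.fstL 2 ℂ F (H2 m G) ∘L V ∘L inl
  let c : E →L[ℂ] H2 m G := WithLp.sndL 2 ℂ F (H2 m G) ∘L V ∘L inl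
  let b : Fin m → H2 m G →L[ℂ] F := fun i => WithLp.fstL 2 ℂ F (H2 m G) ∘L V ∘L inr i
  let d : Fin m → H2 m G →L[ℂ] H2 m G := fun i => WithLp.sndL 2 ℂ F (H2 m G) ∘L V ∘L inr i
  have hab : ∀ e (x : Fin m → H2 m G),
      a e + ∑ i, b i (x i) = (V (WithLp.toLp 2 (e, WithLp.toLp 2 x))).fst := by
    intro e x
    rw [← hsum, ← WithLp.fstL_apply 2 ℂ, map_add, map_add, map_sum, map_sum]
    rfl
  have hcd : ∀ e (x : Fin m → H2 m G),
      c e + ∑ i, d i (x i) = (V (WithLp.toLp 2 (e, WithLp.toLp 2 x))).snd := by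
    intro e x
    rw [← hsum, ← WithLp.sndL_apply 2 ℂ, map_add, map_add, map_sum, map_sum]
    rfl
  have habcd : ∀ e (x : Fin m → H2 m G), ‖a e + ∑ i, b i (x i)‖ ^ 2 + ‖c e + ∑ i, d i (x i)‖ ^ 2 ≤
      ‖e‖ ^ 2 + ∑ i, ‖x i‖ ^ 2 := by
    intro e x
    have h := pow_le_pow_left₀ (norm_nonneg _) (hV (WithLp.toLp 2 (e, WithLp.toLp 2 x))) 2
    rw [WithLp.prod_norm_sq_eq_of_L2, WithLp.prod_norm_sq_eq_of_L2, PiLp.norm_sq_eq_of_L2] at h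
    rw [hab, hcd]
    exact h
  have hSh : ∀ h, S h = WithLp.toLp 2 (A.adjoint h (center m),
      WithLp.toLp 2 fun i => D (backShift G i h)) := by
    intro h; simp [S]
  have hB0 : ∀ h, B.adjoint h (center m) =
      a (A.adjoint h (center m)) + ∑ i, b i (D (backShift G i h)) := by
    intro h
    rw [hab, ← hSh, hVS]
    simp [T]
  have hD0 : ∀ h, D h = c (A.adjoint h (center m)) + ∑ i, d i (D (backShift G i h)) := by
    intro h
    rw [hcd, ← hSh, hVS]
    simp [T]
  clear_value a b c d
  let Z := WithLp 2 (H2 m F × H2 m G)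
  let pair := (WithLp.prodContinuousLinearEquiv 2 ℂ (H2 m F) (H2 m G)).symm.toContinuousLinearMap
  -- The second component iterates the state through `c` and `d`; the first emits a constant through
  -- `a` and `b` and shifts the earlier output. Contractivity combines that of `V` with
  -- `norm_sq_row_le`.
  let U₀ : E →L[ℂ] Z := pair ∘L ((ker F (center m) ∘L a).prod c)
  let U : Fin m → Z →L[ℂ] Z := fun i => pair ∘L
    ((ker F (center m) ∘L b i ∘L WithLp.sndL 2 ℂ _ _ + shift F i ∘L WithLp.fstL 2 ℂ _ _).prod
      (d i ∘L WithLp.sndL 2 ℂ _ _))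
  have hUf : ∀ e (x : Fin m → Z), (U₀ e + ∑ i, U i (x i)).fst =
      ker F (center m) (a e + ∑ i, b i (x i).snd) + ∑ i, shift F i (x i).fst := by
    intro e x
    rw [← WithLp.fstL_apply 2 ℂ, map_add, map_sum]
    simp [U₀, U, pair, Finset.sum_add_distrib, add_assoc]
    rfl
  have hUs : ∀ e (x : Fin m → Z), (U₀ e + ∑ i, U i (x i)).snd = c e + ∑ i, d i (x i).snd := by
    intro e x
    rw [← WithLp.sndL_apply 2 ℂ, map_add, map_sum]
    simp [U₀, U, pair]
    rfl
  have hU : ∀ e (x : Fin m → Z), ‖U₀ e + ∑ i, U i (x i)‖ ^ 2 ≤ ‖e‖ ^ 2 + ∑ i, ‖x i‖ ^ 2 := by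
    intro e x
    rw [WithLp.prod_norm_sq_eq_of_L2, hUf, hUs]
    have h3 : ∑ i, ‖x i‖ ^ 2 = ∑ i, ‖(x i).fst‖ ^ 2 + ∑ i, ‖(x i).snd‖ ^ 2 := by
      rw [← Finset.sum_add_distrib]
      exact Finset.sum_congr rfl fun i _ => WithLp.prod_norm_sq_eq_of_L2 (x i)
    have h1 := norm_sq_row_le (a e + ∑ i, b i (x i).snd) fun i => (x i).fst
    have h2 := habcd e fun i => (x i).snd
    linarith
  obtain ⟨t, ht⟩ := exists_eq_add_sum U₀ U hU
  -- Both `s` and `t ∘L A.adjoint` solve the same recursion over `H2 m G`, so uniqueness forces them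
  -- to agree; the first component is `W A* = B*`.
  let s : H2 m G →L[ℂ] Z := pair ∘L (B.adjoint.prod D)
  have hs : ∀ h, s h = U₀ (A.adjoint h (center m)) + ∑ i, U i (s (backShift G i h)) := by
    intro h
    refine WithLp.ofLp_injective 2 (Prod.ext ?_ ?_)
    · refine Eq.trans ?_ (hUf _ _).symm
      change B.adjoint h = ker F (center m) (a (A.adjoint h (center m)) +
        ∑ i, b i (D (backShift G i h))) + ∑ i, shift F i (B.adjoint (backShift G i h))
      rw [← hB0]
      simp only [hB']
      exact (eq_add_sum_shift_backShift _).symm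
    · refine Eq.trans ?_ (hUs _ _).symm
      exact hD0 h
  have hts : t ∘L A.adjoint - s = 0 := by
    refine eq_zero_of_eq_sum (U := U) (fun x => by simpa using hU 0 x) fun f => ?_
    simp only [sub_apply, comp_apply, map_sub, Finset.sum_sub_distrib, hA']
    rw [ht, hs]
    simp
  let W : H2 m E →L[ℂ] H2 m F := WithLp.fstL 2 ℂ _ _ ∘L t
  let R : H2 m E →L[ℂ] H2 m G := WithLp.sndL 2 ℂ _ _ ∘L t
  obtain ⟨y, hy⟩ : ∃ y : H2 m E →L[ℂ] F,
      W = ker F (center m) ∘L y + ∑ i, shift F i ∘L W ∘L backShift E i := by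
    refine ⟨a ∘L (ker E (center m)).adjoint + ∑ i, b i ∘L R ∘L backShift E i, ?_⟩
    ext1 f
    have h := congrArg WithLp.fst (ht f)
    rw [hUf] at h
    simp only [add_apply, sum_apply, comp_apply, RKHS.adjoint_kerFun]
    exact h
  have hWA : W ∘L A.adjoint = B.adjoint := by
    ext1 h
    exact congrArg (fun T : H2 m G →L[ℂ] Z => (T h).fst) (sub_eq_zero.1 hts)
  clear_value W
  refine ⟨W.adjoint, y.adjoint, ?_, fun f => ?_⟩
  · have h2 := congrArg adjoint hWA
    rwa [adjoint_comp, adjoint_adjoint, adjoint_adjoint] at h2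
  · have h2 := congrArg (fun T => adjoint T f) hy
    simpa only [map_add, adjoint_comp, map_sum, add_apply, sum_apply, comp_apply,
      RKHS.adjoint_kerFun, adjoint_adjoint] using h2

/-! ### Complemented ranges and the theorem. -/

/-- Multiplication operators are module maps. -/
lemma M_shift (φ : Multiplier m E F) (i : Fin m) (f : H2 m E) :
    M φ (shift E i f) = shift F i (M φ f) := by
  refine RKHS.ext fun z => ?_
  rw [M_apply, shift_apply, shift_apply, map_smul, M_apply]

/-- The projection onto a range along a closed complement factors through the operator. -/
lemma exists_lift_of_isCompl {H K : Type*} [NormedAddCommGroup H] [InnerProductSpace ℂ H]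
    [CompleteSpace H] [NormedAddCommGroup K] [InnerProductSpace ℂ K] [CompleteSpace K]
    (A : H →L[ℂ] K) {S : Submodule ℂ K} (h : IsCompl A.range S) (hS : IsClosed (S : Set K)) :
    ∃ C : K →L[ℂ] H, ∀ f, (f ∈ A.range → A (C f) = f) ∧ (f ∈ S → A (C f) = 0) := by
  have : CompleteSpace S := hS.completeSpace_coe
  have : CompleteSpace A.ker := A.isClosed_ker.completeSpace_coe
  let A' : A.kerᗮ →L[ℂ] K := A ∘L A.kerᗮ.subtypeL
  have hproj : ∀ g, ∃ g' : A.kerᗮ, A' g' = A g := by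
    intro g
    refine ⟨A.kerᗮ.orthogonalProjectionOnto g, ?_⟩
    have h1 : A (g - A.kerᗮ.orthogonalProjectionOnto g) = 0 := by
      have := Submodule.sub_starProjection_mem_orthogonal (K := A.kerᗮ) g
      rw [Submodule.orthogonal_orthogonal] at this
      exact this
    rw [map_sub, sub_eq_zero] at h1
    exact h1.symm
  have hrange : A'.range = A.range := by
    ext f
    constructor
    · rintro ⟨g, rfl⟩
      exact ⟨g, rfl⟩
    · rintro ⟨g, rfl⟩
      exact hproj g
  have hker : A'.ker = ⊥ := by
    refine (Submodule.eq_bot_iff _).2 fun g hg => ?_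
    have h1 : (g : H) ∈ A.ker ⊓ A.kerᗮ := ⟨hg, g.2⟩
    rw [Submodule.inf_orthogonal_eq_bot] at h1
    exact Subtype.ext h1
  -- On `A.kerᗮ` the operator is injective with the same range, so `(x, y) ↦ A' x + y` is a bounded
  -- bijection of Banach spaces and has a bounded inverse. Closedness of the range need not be known
  -- beforehand.
  let e := A'.coprodSubtypeLEquivOfIsCompl (hrange ▸ h) hker
  have he : ∀ x y, e (x, y) = A' x + y := fun x y => rfl
  refine ⟨A.kerᗮ.subtypeL ∘L ContinuousLinearMap.fst ℂ _ _ ∘L e.symm.toContinuousLinearMap,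
    fun f => ⟨?_, fun hf => ?_⟩⟩
  · rintro ⟨g, rfl⟩
    obtain ⟨g', hg'⟩ := hproj g
    have h1 : e.symm (A g) = (g', 0) := by
      rw [ContinuousLinearEquiv.symm_apply_eq, he, hg']; simp
    change A (e.symm (A g)).1 = A g
    rw [h1]
    exact hg'
  · have h1 : e.symm f = (0, ⟨f, hf⟩) := by
      rw [ContinuousLinearEquiv.symm_apply_eq, he]; simp
    change A (e.symm f).1 = 0
    rw [h1]
    simp

end DruryArveson
end

open DruryArveson in
theorem mainTheorem2 (m : ℕ) {E F : Type*}
    [NormedAddCommGroup E] [InnerProductSpace ℂ E] [CompleteSpace E]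
    [NormedAddCommGroup F] [InnerProductSpace ℂ F] [CompleteSpace F]
    (θ : DruryArveson.Multiplier m E F) :
    (∃ ψ : DruryArveson.Multiplier m F E,
      DruryArveson.M θ ∘L DruryArveson.M ψ ∘L DruryArveson.M θ = DruryArveson.M θ) ↔
    ∃ S : Submodule ℂ (DruryArveson.H2 m F), DruryArveson.IsClosedSubmodule S ∧
      IsCompl (LinearMap.range (DruryArveson.M θ).toLinearMap) S := by
  constructor
  · rintro ⟨ψ, hψ⟩
    have h : ∀ f, M θ (M ψ (M θ f)) = M θ f := fun f => congrArg (fun T => T f) hψ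
    refine ⟨(M θ ∘L M ψ).ker, ⟨(M θ ∘L M ψ).isClosed_ker, fun i f hf => ?_⟩, ?_⟩
    · have hf' : M θ (M ψ f) = 0 := hf
      change M θ (M ψ (M (coord F i) f)) = 0
      rw [M_shift, M_shift, hf', map_zero]
    · rw [isCompl_iff, disjoint_iff_inf_le, codisjoint_iff_le_sup]
      constructor
      · rintro _ ⟨⟨g, rfl⟩, hg⟩
        have hg' : M θ (M ψ (M θ g)) = 0 := hg
        rw [h] at hg'
        exact hg'
      · intro f _
        rw [← add_sub_cancel (M θ (M ψ f)) f]
        refine Submodule.add_mem_sup ⟨_, rfl⟩ ?_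
        change M θ (M ψ (f - M θ (M ψ f))) = 0
        rw [map_sub, map_sub, h, sub_self]
  · rintro ⟨S, hS, hc⟩
    obtain ⟨C, hC⟩ := exists_lift_of_isCompl (M θ) hc hS.isClosed
    have hP : ∀ f, M θ (C (M θ f)) = M θ f := fun f => (hC _).1 ⟨f, rfl⟩
    -- Both summands are invariant under the shifts, so the projection commutes with them.
    have hB : ∀ i f, (M θ ∘L C) (shift F i f) = shift F i ((M θ ∘L C) f) := by
      intro i f
      obtain ⟨r, ⟨g, rfl⟩, s, hs, rfl⟩ := Submodule.mem_sup.1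
        (hc.sup_eq_top ▸ Submodule.mem_top : f ∈ (M θ).range ⊔ S)
      have h1 := hP g
      have h2 := hP (shift E i g)
      rw [M_shift] at h2
      have h3 := (hC s).2 hs
      have h4 := (hC _).2 (hS.coord_mem i s hs)
      change M θ (C (shift F i (M θ g + s))) = shift F i (M θ (C (M θ g + s)))
      simp only [map_add, h1, h2, h3, h4, map_zero]
    have hAB : ∀ h, ‖(M θ ∘L C).adjoint h‖ ≤ ‖(((‖C‖ : ℝ) : ℂ) • M θ).adjoint h‖ := by
      intro h
      rw [ContinuousLinearMap.adjoint_comp, ContinuousLinearMap.comp_apply]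
      refine (C.adjoint.le_opNorm _).trans ?_
      rw [map_smulₛₗ, smul_apply, norm_smul]
      simp
    -- Leech's theorem is stated with constant one, so `‖C‖` is put on `M θ` and afterwards moved
    -- onto `X`; no division occurs, and `‖C‖ = 0` is no exception.
    obtain ⟨X, Y, hX, hXY⟩ := exists_comp_eq_of_norm_adjoint_le (((‖C‖ : ℝ) : ℂ) • M θ)
      (M θ ∘L C) (fun i f => by simp [M_shift]) hB hAB
    obtain ⟨ψ, hψ⟩ := exists_multiplier (((‖C‖ : ℝ) : ℂ) • X) (((‖C‖ : ℝ) : ℂ) • Y)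
      (fun f => by
        simp only [smul_apply]
        rw [hXY f]
        simp [Finset.smul_sum])
    refine ⟨ψ, ?_⟩
    ext1 f
    have := congrArg (fun T => T (M θ f)) hX
    simpa [hψ, hP] using this
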